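/- **Definitions.** All spaces are real normed spaces. A semi-inner product on $\mathbb{X}$ is a function $[\cdot,\cdot]:\mathbb{X}\times\mathbb{X}\to\mathbb{R}$ that is linear in the first variable, satisfies $[x,x]>0$ for $x\neq 0$, $|[x,y]|^2\le [x,x][y,y]$, $[x,\alpha y]=\alpha[x,y]$, and is compatible with the norm: $\|x\|=[x,x]^{1/2}$. For a bounded linear operator $T:\mathbb{X}\to\mathbb{X}$, a scalar $k$ is a *level number* of $T$ if there are a nonzero $x\in\mathbb{X}$ and semi-inner products $[\cdot,\cdot]_1$, $[\cdot,\cdot]_2$ on $\mathbb{X}$ (not necessarily equal) with $[Ty,Tx]_2=k[y,x]_1$ for all $y\in\mathbb{X}$; $L(T)$ is the set of all level numbers of $T$. A finite-dimensional real Banach space $\mathbb{X}$ is *polyhedral* if its closed unit ball $B_{\mathbb{X}}$ is a polyhedron, i.e. an intersection of finitely many closed half-spaces. A *face* of $B_{\mathbb{X}}$ is a nonempty convex subset $F$ of the unit sphere $S_{\mathbb{X}}$ such that $(1-t)u+tv\in F$ with $u,v\in S_{\mathbb{X}}$ and $0<t<1$ implies $u,v\in F$; it is a *$k$-face* if its affine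 hull has dimension $k$. **Theorem.** Let $\mathbb{X}$ be an $n$-dimensional real polyhedral Banach space and let $T:\mathbb{X}\to\mathbb{X}$ be a linear operator. Let $F_k$ be the collection of all $k$-faces of $B_{\mathbb{X}}$ and $G_k$ the collection of all $k$-faces of $B_{\ker T}$, the unit ball of $\ker T$ with the norm of $\mathbb{X}$. Then all the collections $F_k$ and $G_k$ and the set $L(T)$ are finite, and $$|L(T)|\le\begin{cases}\dfrac12\left(\displaystyle\sum_{k=0}^{n-1}|F_k|-\sum_{k=0}^{m-1}|G_k|\right)+1, & \text{if } \dim(\ker T)=m>0,\\[3mm] \dfrac12\displaystyle\sum_{k=0}^{n-1}|F_k|, & \text{if } \dim(\ker T)=0.\end{cases}$$ -/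

import Mathlib

/-- A semi-inner product on a real normed space, compatible with the norm. -/
structure SemiInnerProduct (E : Type*) [NormedAddCommGroup E] [NormedSpace ℝ E] where
  toFun : E → E → ℝ
  linear_left : ∀ (a b : ℝ) (x y z : E),
    toFun (a • x + b • y) z = a * toFun x z + b * toFun y z
  pos : ∀ x : E, x ≠ 0 → 0 < toFun x x
  cauchy_schwarz : ∀ x y : E, |toFun x y| ^ 2 ≤ toFun x x * toFun y y
  smul_right : ∀ (a : ℝ) (x y : E), toFun x (a • y) = a * toFun x y
  norm_eq : ∀ x : E, ‖x‖ = Real.sqrt (toFun x x)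

/-- `k` is a level number of `T`: there are a nonzero `x` and semi-inner products on the domain and
on the codomain (both generating the given norms) with `[T y, T x] = k [y, x]` for all `y`. -/
def IsLevelNumber {E F : Type*} [NormedAddCommGroup E] [NormedSpace ℝ E]
    [NormedAddCommGroup F] [NormedSpace ℝ F] (T : E →L[ℝ] F) (k : ℝ) : Prop :=
  ∃ x : E, x ≠ 0 ∧ ∃ (p : SemiInnerProduct E) (q : SemiInnerProduct F),
    ∀ y : E, q.toFun (T y) (T x) = k * p.toFun y x

/-- The set `L(T)` of all level numbers of `T`. -/
def levelNumbers {E F : Type*} [NormedAddCommGroup E] [NormedSpace ℝ E]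
    [NormedAddCommGroup F] [NormedSpace ℝ F] (T : E →L[ℝ] F) : Set ℝ :=
  {k : ℝ | IsLevelNumber T k}

/-- The closed unit ball is a polyhedron, i.e. an intersection of finitely many
closed half-spaces. -/
def IsPolyhedralSpace (E : Type*) [NormedAddCommGroup E] [NormedSpace ℝ E] : Prop :=
  FiniteDimensional ℝ E ∧ ∃ s : Finset ((E →L[ℝ] ℝ) × ℝ),
    Metric.closedBall (0 : E) 1 = {x : E | ∀ h ∈ s, h.1 x ≤ h.2}

/-- A (nonempty, proper) face of the closed unit ball: a convex subset `F` of the unit sphere such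
that any two points of the sphere having a proper convex combination in `F` lie in `F`. -/
def IsUnitBallFace {E : Type*} [NormedAddCommGroup E] [NormedSpace ℝ E] (F : Set E) : Prop :=
  F.Nonempty ∧ Convex ℝ F ∧ F ⊆ Metric.sphere (0 : E) 1 ∧
    ∀ u ∈ Metric.sphere (0 : E) 1, ∀ v ∈ Metric.sphere (0 : E) 1, ∀ t : ℝ, 0 < t → t < 1 →
      (1 - t) • u + t • v ∈ F → u ∈ F ∧ v ∈ F

/-- The `k`-faces of the closed unit ball: the faces whose affine hull has dimension `k`. -/
def unitBallFaces (E : Type*) [NormedAddCommGroup E] [NormedSpace ℝ E] (k : ℕ) : Set (Set E) :=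
  {F : Set E | IsUnitBallFace F ∧ Module.finrank ℝ (affineSpan ℝ F).direction = k}

/-!
Every face of a polyhedral unit ball is the minimal face `minFace y` of one of its points `y`
(take `y` satisfying as few of the defining inequalities with equality as possible,
`IsUnitBallFace.exists_eq_minFace`), and `minFace y` is determined by the inequalities that are
equalities at `y`; hence there are finitely many faces.

A level number `k` is attained at a unit vector `u`, and then `k = ‖T u‖ ^ 2`. The semi-inner
product `[·, u]₁` is a norm-one functional supporting the ball at `u`, so it equals `1` on all of
`minFace u`; for `w` in `minFace u` this gives
`k = k [w, u]₁ = [T w, T u]₂ ≤ ‖T w‖ ‖T u‖`, that is `‖T u‖ ≤ ‖T w‖`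
(`IsLevelVector.norm_le_of_mem_minFace`). By symmetry `k` depends on `minFace u` only, and it is
zero as soon as `minFace u` is also the minimal face of a vector of `ker T`. Since `-u` is a
witness for `k` as well and `minFace (-u) ≠ minFace u`, each nonzero level number uses up two faces
of the unit ball of `X`, none of which is the minimal face of a vector of `ker T`. Finally, the
minimal face in `ker T` of a vector `y` is the trace on `ker T` of its minimal face in `X`, so the
faces of the unit ball of `ker T` inject into the faces of the unit ball of `X` that are minimal
faces of vectors of `ker T`. Counting gives `two_mul_ncard_add_ncard_le`, which contains both cases
of the bound.
-/

/-! ### Minimal faces of the unit ball -/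

section MinimalFace

variable {E : Type*} [NormedAddCommGroup E] [NormedSpace ℝ E]

/-- The smallest face of the closed unit ball containing the unit vector `y`: the points `x` of the
ball such that the segment from `x` to `y` can be prolonged beyond `y` inside the ball. -/
def minFace (y : E) : Set E :=
  {x | ‖x‖ ≤ 1 ∧ ∃ ε : ℝ, 0 < ε ∧ ‖y + ε • (y - x)‖ ≤ 1}

theorem self_mem_minFace {y : E} (hy : ‖y‖ = 1) : y ∈ minFace y :=
  ⟨hy.le, 1, one_pos, by simp [hy]⟩

/-- A functional of norm at most one that attains the value `1` at `y` is at least `1` on the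
minimal face of `y`. -/
theorem one_le_of_mem_minFace {y x : E} (hx : x ∈ minFace y) (f : E →ₗ[ℝ] ℝ)
    (hf : ∀ z, f z ≤ ‖z‖) (hfy : f y = 1) : 1 ≤ f x := by
  obtain ⟨-, ε, hε, h⟩ := hx
  have := (hf _).trans h
  simp only [map_add, map_smul, map_sub, smul_eq_mul, hfy] at this
  nlinarith

theorem norm_eq_one_of_mem_minFace {y x : E} (hy : ‖y‖ = 1) (hx : x ∈ minFace y) : ‖x‖ = 1 := by
  obtain ⟨h1, ε, hε, h⟩ := hx
  have e : (1 + ε) • y = (y + ε • (y - x)) + ε • x := by module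
  have := norm_add_le (y + ε • (y - x)) (ε • x)
  rw [← e, norm_smul, norm_smul, hy, Real.norm_of_nonneg (by positivity),
    Real.norm_of_nonneg hε.le] at this
  nlinarith

theorem norm_add_smul_sub_le_of_le {y x : E} (hy : ‖y‖ ≤ 1) {δ ε : ℝ} (hδ : 0 ≤ δ) (hε : 0 < ε)
    (hδε : δ ≤ ε) (h : ‖y + ε • (y - x)‖ ≤ 1) : ‖y + δ • (y - x)‖ ≤ 1 := by
  have e : y + δ • (y - x) = (1 - δ / ε) • y + (δ / ε) • (y + ε • (y - x)) := by
    match_scalars <;> field_simp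
    ring
  have hq : δ / ε ≤ 1 := (div_le_one hε).2 hδε
  have := convex_closedBall (0 : E) 1 (mem_closedBall_zero_iff.2 hy)
    (mem_closedBall_zero_iff.2 h) (sub_nonneg.2 hq) (div_nonneg hδ hε.le) (by ring)
  rw [e]
  exact mem_closedBall_zero_iff.1 this

theorem convex_minFace {y : E} (hy : ‖y‖ ≤ 1) : Convex ℝ (minFace y) := by
  rintro x₁ ⟨hx₁, ε₁, hε₁, h₁⟩ x₂ ⟨hx₂, ε₂, hε₂, h₂⟩ a b ha hb hab
  have hε : 0 < min ε₁ ε₂ := lt_min hε₁ hε₂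
  refine ⟨?_, min ε₁ ε₂, hε, ?_⟩
  · exact mem_closedBall_zero_iff.1 (convex_closedBall (0 : E) 1 (mem_closedBall_zero_iff.2 hx₁)
      (mem_closedBall_zero_iff.2 hx₂) ha hb hab)
  · have k₁ := norm_add_smul_sub_le_of_le hy hε.le hε₁ (min_le_left _ _) h₁
    have k₂ := norm_add_smul_sub_le_of_le hy hε.le hε₂ (min_le_right _ _) h₂
    have := mem_closedBall_zero_iff.1 (convex_closedBall (0 : E) 1 (mem_closedBall_zero_iff.2 k₁)
      (mem_closedBall_zero_iff.2 k₂) ha hb hab)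
    obtain rfl : b = 1 - a := by linarith
    have e : y + min ε₁ ε₂ • (y - (a • x₁ + (1 - a) • x₂)) =
        a • (y + min ε₁ ε₂ • (y - x₁)) + (1 - a) • (y + min ε₁ ε₂ • (y - x₂)) := by module
    rwa [e]

theorem left_mem_minFace {y u v : E} {t : ℝ} (hu : ‖u‖ ≤ 1) (hv : ‖v‖ ≤ 1) (ht₀ : 0 < t)
    (ht₁ : t < 1) (h : (1 - t) • u + t • v ∈ minFace y) : u ∈ minFace y := by
  obtain ⟨-, ε, hε, h⟩ := h
  have hp : 0 < 1 + ε * t := by positivity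
  refine ⟨hu, ε * (1 - t) / (1 + ε * t), div_pos (mul_pos hε (sub_pos.2 ht₁)) hp, ?_⟩
  -- The prolonged point lies between `v` and the prolongation of the segment from
  -- `(1 - t) u + t v` to `y`.
  have e : y + (ε * (1 - t) / (1 + ε * t)) • (y - u) =
      (1 / (1 + ε * t)) • (y + ε • (y - ((1 - t) • u + t • v)))
        + (ε * t / (1 + ε * t)) • v := by
    match_scalars <;> field_simp <;> ring_nf
  rw [e]
  exact mem_closedBall_zero_iff.1 (convex_closedBall (0 : E) 1 (mem_closedBall_zero_iff.2 h)
      (mem_closedBall_zero_iff.2 hv) (by positivity) (by positivity) (by field_simp))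

theorem isUnitBallFace_minFace {y : E} (hy : ‖y‖ = 1) : IsUnitBallFace (minFace y) := by
  refine ⟨⟨y, self_mem_minFace hy⟩, convex_minFace hy.le,
    fun x hx => mem_sphere_zero_iff_norm.2 (norm_eq_one_of_mem_minFace hy hx), ?_⟩
  intro u hu v hv t ht₀ ht₁ h
  rw [mem_sphere_zero_iff_norm] at hu hv
  refine ⟨left_mem_minFace hu.le hv.le ht₀ ht₁ h,
    left_mem_minFace (t := 1 - t) hv.le hu.le (by linarith) (by linarith) ?_⟩
  rwa [sub_sub_cancel, add_comm]

theorem minFace_subset {F : Set E} (hF : IsUnitBallFace F) {y : E} (hy : y ∈ F) :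
    minFace y ⊆ F := by
  have hy1 := mem_sphere_zero_iff_norm.1 (hF.2.2.1 hy)
  intro x hx
  have hx1 := norm_eq_one_of_mem_minFace hy1 hx
  obtain ⟨-, ε, hε, h⟩ := hx
  have e : (1 - 1 / (1 + ε)) • x + (1 / (1 + ε)) • (y + ε • (y - x)) = y := by
    match_scalars <;> field_simp
    ring
  have hz : ‖y + ε • (y - x)‖ = 1 := by
    refine le_antisymm h ?_
    have e' : (1 + ε) • y = (y + ε • (y - x)) + ε • x := by module
    have := norm_add_le (y + ε • (y - x)) (ε • x)
    rw [← e', norm_smul, norm_smul, hy1, hx1, Real.norm_of_nonneg (by positivity),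
      Real.norm_of_nonneg hε.le] at this
    linarith
  refine (hF.2.2.2 x (mem_sphere_zero_iff_norm.2 hx1) _ (mem_sphere_zero_iff_norm.2 hz)
    (1 / (1 + ε)) (by positivity) ?_ (by rwa [e])).1
  rw [div_lt_one (by positivity)]
  linarith

theorem neg_notMem_minFace {y : E} (hy : ‖y‖ = 1) : -y ∉ minFace y := by
  rintro ⟨-, ε, hε, h⟩
  have e : y + ε • (y - -y) = (1 + 2 * ε) • y := by module
  rw [e, norm_smul, hy, Real.norm_of_nonneg (by positivity)] at h
  linarith

theorem coe_mem_minFace_iff {W : Submodule ℝ E} {x y : W} :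
    (x : E) ∈ minFace (y : E) ↔ x ∈ minFace y :=
  Iff.rfl

end MinimalFace

/-! ### Faces of a polyhedral unit ball -/

section Polyhedral

variable {E : Type*} [NormedAddCommGroup E] [NormedSpace ℝ E]

/-- In a ball cut out by finitely many inequalities, the minimal face of `y` consists of the points
at which every inequality that is an equality at `y` is an equality. -/
theorem minFace_eq_of_closedBall_eq {s : Finset ((E →L[ℝ] ℝ) × ℝ)}
    (hs : Metric.closedBall (0 : E) 1 = {x : E | ∀ h ∈ s, h.1 x ≤ h.2}) {y : E} (hy : ‖y‖ = 1) :
    minFace y = {x | ‖x‖ ≤ 1 ∧ ∀ h ∈ s.filter (fun h => h.1 y = h.2), h.1 x = h.2} := by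
  have hball : ∀ z : E, ‖z‖ ≤ 1 ↔ ∀ h ∈ s, h.1 z ≤ h.2 := fun z => by
    rw [← mem_closedBall_zero_iff, hs, Set.mem_ofPred_eq]
  ext x
  refine and_congr_right fun hx => ⟨?_, ?_⟩
  · rintro ⟨ε, hε, h⟩ g hg
    obtain ⟨hgs, hgy⟩ := Finset.mem_filter.1 hg
    have h1 := (hball _).1 h g hgs
    have h2 := (hball _).1 hx g hgs
    simp only [map_add, map_smul, map_sub, smul_eq_mul, hgy] at h1
    nlinarith
  · intro hact
    -- The inequalities that are strict at `y` stay true near `y`.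
    have key : ∀ g ∈ s, ∀ᶠ ε : ℝ in nhdsWithin 0 (Set.Ioi 0), g.1 (y + ε • (y - x)) ≤ g.2 := by
      intro g hg
      by_cases hgy : g.1 y = g.2
      · have := hact g (Finset.mem_filter.2 ⟨hg, hgy⟩)
        filter_upwards with ε
        simp [hgy, this]
      · have hlt : g.1 y < g.2 := lt_of_le_of_ne ((hball y).1 hy.le g hg) hgy
        have hc : Continuous fun ε : ℝ => g.1 (y + ε • (y - x)) := by fun_prop
        have ht : Filter.Tendsto (fun ε : ℝ => g.1 (y + ε • (y - x))) (nhds 0)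
            (nhds (g.1 y)) := by
          simpa using hc.tendsto 0
        filter_upwards [(ht.mono_left nhdsWithin_le_nhds).eventually_lt_const hlt] with ε h
        exact h.le
    obtain ⟨ε, h, hε⟩ := (((Finset.eventually_all s).2 key).and self_mem_nhdsWithin).exists
    exact ⟨ε, hε, (hball _).2 h⟩

/-- Every face of a polyhedral unit ball is the minimal face of one of its points. -/
theorem IsUnitBallFace.exists_eq_minFace (hE : IsPolyhedralSpace E) {F : Set E}
    (hF : IsUnitBallFace F) : ∃ y, ‖y‖ = 1 ∧ F = minFace y := by
  classical
  obtain ⟨-, s, hs⟩ := hE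
  have hball : ∀ z : E, ‖z‖ ≤ 1 ↔ ∀ h ∈ s, h.1 z ≤ h.2 := fun z => by
    rw [← mem_closedBall_zero_iff, hs, Set.mem_ofPred_eq]
  -- A point of `F` with the least number of active inequalities.
  obtain ⟨y, hyF, hmin⟩ := exists_minimalFor_of_wellFoundedLT (· ∈ F)
    (fun y : E => (s.filter (fun h : (E →L[ℝ] ℝ) × ℝ => h.1 y = h.2)).card) hF.1
  have hF1 : ∀ {z}, z ∈ F → ‖z‖ = 1 := fun hz => mem_sphere_zero_iff_norm.1 (hF.2.2.1 hz)
  refine ⟨y, hF1 hyF, (minFace_subset hF hyF).antisymm' ?_⟩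
  intro x hxF
  rw [minFace_eq_of_closedBall_eq hs (hF1 hyF)]
  refine ⟨(hF1 hxF).le, ?_⟩
  -- An inequality active at the midpoint of `x` and `y` is active at both endpoints.
  have hmid : (1 / 2 : ℝ) • x + (1 / 2 : ℝ) • y ∈ F :=
    hF.2.1 hxF hyF (by norm_num) (by norm_num) (by norm_num)
  have hboth : ∀ h ∈ s, h.1 ((1 / 2 : ℝ) • x + (1 / 2 : ℝ) • y) = h.2 →
      h.1 x = h.2 ∧ h.1 y = h.2 := by
    intro h hh he
    have h1 := (hball x).1 (hF1 hxF).le h hh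
    have h2 := (hball y).1 (hF1 hyF).le h hh
    simp only [map_add, map_smul, smul_eq_mul] at he
    constructor <;> linarith
  have hsub : s.filter (fun h => h.1 ((1 / 2 : ℝ) • x + (1 / 2 : ℝ) • y) = h.2) ⊆
      s.filter (fun h => h.1 y = h.2) := by
    intro h hh
    rw [Finset.mem_filter] at hh ⊢
    exact ⟨hh.1, (hboth h hh.1 hh.2).2⟩
  have heq := Finset.eq_of_subset_of_card_le hsub (hmin hmid (Finset.card_le_card hsub))
  intro h hh
  rw [← heq, Finset.mem_filter] at hh
  exact (hboth h hh.1 hh.2).1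

theorem IsPolyhedralSpace.finite_setOf_isUnitBallFace (hE : IsPolyhedralSpace E) :
    {F : Set E | IsUnitBallFace F}.Finite := by
  classical
  obtain ⟨s, hs⟩ := hE.2
  refine ((s.powerset.finite_toSet).image
    fun A => {x : E | ‖x‖ ≤ 1 ∧ ∀ h ∈ A, h.1 x = h.2}).subset ?_
  intro F hF
  obtain ⟨y, hy, rfl⟩ := IsUnitBallFace.exists_eq_minFace hE hF
  exact ⟨s.filter (fun h => h.1 y = h.2),
    Finset.mem_coe.2 (Finset.mem_powerset.2 (Finset.filter_subset _ _)),
    (minFace_eq_of_closedBall_eq hs hy).symm⟩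

theorem IsPolyhedralSpace.submodule (hE : IsPolyhedralSpace E) (W : Submodule ℝ E) :
    IsPolyhedralSpace W := by
  classical
  obtain ⟨hfd, s, hs⟩ := hE
  refine ⟨inferInstance, s.image fun h => (h.1.comp W.subtypeL, h.2), ?_⟩
  ext x
  have h : ‖(x : E)‖ ≤ 1 ↔ ∀ h ∈ s, h.1 x ≤ h.2 := by
    rw [← mem_closedBall_zero_iff, hs, Set.mem_ofPred_eq]
  rw [mem_closedBall_zero_iff, Set.mem_ofPred_eq, Finset.forall_mem_image]
  exact h

/-- A face lies in a supporting hyperplane that misses the origin, so its dimension is less than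
that of the space. -/
theorem IsUnitBallFace.finrank_direction_lt (hE : IsPolyhedralSpace E) {F : Set E}
    (hF : IsUnitBallFace F) :
    Module.finrank ℝ (affineSpan ℝ F).direction < Module.finrank ℝ E := by
  have := hE.1
  obtain ⟨y, hy, rfl⟩ := hF.exists_eq_minFace hE
  obtain ⟨f, hf, hfy⟩ := exists_dual_vector ℝ y (norm_ne_zero_iff.1 (by simp [hy]))
  have hfy : f y = 1 := by simpa [hy] using hfy
  have hle : ∀ z, f z ≤ ‖z‖ := fun z => by
    simpa [hf] using (le_abs_self _).trans (f.le_opNorm z)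
  have hone : ∀ x ∈ minFace y, f x = 1 := fun x hx =>
    le_antisymm ((hle x).trans hx.1) (one_le_of_mem_minFace hx f.toLinearMap hle hfy)
  refine Submodule.finrank_lt (ne_top_of_le_ne_top (b := f.toLinearMap.ker) ?_ ?_)
  · intro h
    have : y ∈ f.toLinearMap.ker := h ▸ Submodule.mem_top
    have : f y = 0 := this
    linarith
  · rw [direction_affineSpan, vectorSpan_def, Submodule.span_le]
    rintro _ ⟨a, ha, b, hb, rfl⟩
    simp [hone a ha, hone b hb]

theorem sum_ncard_unitBallFaces (hE : IsPolyhedralSpace E) :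
    ∑ k ∈ Finset.range (Module.finrank ℝ E), (unitBallFaces E k).ncard =
      {F : Set E | IsUnitBallFace F}.ncard := by
  classical
  have hfin := hE.finite_setOf_isUnitBallFace
  rw [Set.ncard_eq_toFinset_card _ hfin, Finset.card_eq_sum_card_fiberwise
    (f := fun F : Set E => Module.finrank ℝ (affineSpan ℝ F).direction)
    (t := Finset.range (Module.finrank ℝ E))]
  · refine Finset.sum_congr rfl fun k _ => ?_
    rw [← Set.ncard_coe_finset]
    congr 1
    ext F
    simp [unitBallFaces]
  · intro F hF
    have hF : IsUnitBallFace F := by simpa using hF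
    simpa using hF.finrank_direction_lt hE

end Polyhedral

/-! ### Level numbers -/

section LevelNumbers

variable {E F : Type*} [NormedAddCommGroup E] [NormedSpace ℝ E]
  [NormedAddCommGroup F] [NormedSpace ℝ F]

theorem SemiInnerProduct.self_eq (p : SemiInnerProduct E) (x : E) : p.toFun x x = ‖x‖ ^ 2 := by
  have h : 0 ≤ p.toFun x x := by
    by_cases hx : x = 0
    · have := p.smul_right 0 x x
      simp only [zero_smul, zero_mul] at this
      rw [hx] at this ⊢
      exact this.ge
    · exact (p.pos x hx).le
  rw [p.norm_eq, Real.sq_sqrt h]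

theorem SemiInnerProduct.le_norm_mul_norm (p : SemiInnerProduct E) (x y : E) :
    p.toFun x y ≤ ‖x‖ * ‖y‖ := by
  have h := p.cauchy_schwarz x y
  rw [p.self_eq, p.self_eq, ← mul_pow] at h
  exact (le_abs_self _).trans (le_of_sq_le_sq h (by positivity))

/-- The functional `[·, x]`. -/
def SemiInnerProduct.leftLinear (p : SemiInnerProduct E) (x : E) : E →ₗ[ℝ] ℝ where
  toFun y := p.toFun y x
  map_add' y z := by simpa using p.linear_left 1 1 y z x
  map_smul' a y := by simpa using p.linear_left a 0 y 0 x

/-- `u` is a unit vector witnessing that `k` is a level number of `T`. -/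
def IsLevelVector (T : E →L[ℝ] F) (k : ℝ) (u : E) : Prop :=
  ‖u‖ = 1 ∧ ∃ (p : SemiInnerProduct E) (q : SemiInnerProduct F),
    ∀ y : E, q.toFun (T y) (T u) = k * p.toFun y u

theorem IsLevelNumber.exists_isLevelVector {T : E →L[ℝ] F} {k : ℝ} (h : IsLevelNumber T k) :
    ∃ u, IsLevelVector T k u := by
  obtain ⟨x, hx, p, q, h⟩ := h
  refine ⟨‖x‖⁻¹ • x, by simp [norm_smul, hx], p, q, fun y => ?_⟩
  rw [map_smul, q.smul_right, p.smul_right, h]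
  ring

namespace IsLevelVector

variable {T : E →L[ℝ] F} {k l : ℝ} {u v : E}

theorem neg (h : IsLevelVector T k u) : IsLevelVector T k (-u) := by
  obtain ⟨hu, p, q, h⟩ := h
  refine ⟨by rwa [norm_neg], p, q, fun y => ?_⟩
  rw [← neg_one_smul ℝ u, map_smul, q.smul_right, p.smul_right, h]
  ring

theorem eq_norm_sq (h : IsLevelVector T k u) : k = ‖T u‖ ^ 2 := by
  obtain ⟨hu, p, q, h⟩ := h
  have := h u
  rw [p.self_eq, q.self_eq, hu] at this
  linarith

/-- A level vector minimises `‖T ·‖` on its minimal face. -/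
theorem norm_le_of_mem_minFace (h : IsLevelVector T k u) {w : E} (hw : w ∈ minFace u) :
    ‖T u‖ ≤ ‖T w‖ := by
  have hk := h.eq_norm_sq
  obtain ⟨hu, p, q, h⟩ := h
  have h1 : 1 ≤ p.toFun w u := one_le_of_mem_minFace hw (p.leftLinear u)
    (fun z => (p.le_norm_mul_norm z u).trans_eq (by rw [hu, mul_one])) ((p.self_eq u).trans (by simp [hu]))
  have h2 := q.le_norm_mul_norm (T w) (T u)
  rw [h w, hk] at h2
  by_contra! hlt
  have h0 := norm_nonneg (T w)
  nlinarith [mul_pos (h0.trans_lt hlt) (h0.trans_lt hlt)]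

/-- A level number is determined by the minimal face of a level vector. -/
theorem eq_of_minFace_eq (hu : IsLevelVector T k u) (hv : IsLevelVector T l v)
    (h : minFace u = minFace v) : k = l := by
  rw [hu.eq_norm_sq, hv.eq_norm_sq]
  congr 1
  exact le_antisymm (hu.norm_le_of_mem_minFace (h ▸ self_mem_minFace hv.1))
    (hv.norm_le_of_mem_minFace (h ▸ self_mem_minFace hu.1))

end IsLevelVector

/-- The counting inequality: two faces of the ball of `E` for each nonzero level number, and one
more for each face of the ball of the kernel. -/
theorem two_mul_ncard_add_ncard_le (hE : IsPolyhedralSpace E) (T : E →L[ℝ] F) :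
    (levelNumbers T \ {0}).Finite ∧
      2 * (levelNumbers T \ {0}).ncard + {G : Set T.ker | IsUnitBallFace G}.ncard ≤
        {G : Set E | IsUnitBallFace G}.ncard := by
  have hfin := hE.finite_setOf_isUnitBallFace
  have hW := hE.submodule T.ker
  have := hfin.to_subtype
  have := hW.finite_setOf_isUnitBallFace.to_subtype
  choose u hu using fun k : (levelNumbers T \ {0} : Set ℝ) =>
    IsLevelNumber.exists_isLevelVector (T := T) k.2.1
  choose y hy hG using fun G : {G : Set T.ker | IsUnitBallFace G} =>
    IsUnitBallFace.exists_eq_minFace hW G.2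
  have hy' : ∀ G, ‖(y G : E)‖ = 1 := hy
  -- The faces of the vectors `u k`, of the vectors `-u k`, and of the vectors `y G`.
  let f : ((levelNumbers T \ {0} : Set ℝ) ⊕ (levelNumbers T \ {0} : Set ℝ)) ⊕
      {G : Set T.ker | IsUnitBallFace G} → {G : Set E | IsUnitBallFace G} :=
    Sum.elim (Sum.elim (fun k => ⟨minFace (u k), isUnitBallFace_minFace (hu k).1⟩)
      (fun k => ⟨minFace (-u k), isUnitBallFace_minFace (hu k).neg.1⟩))
      (fun G => ⟨minFace (y G : E), isUnitBallFace_minFace (hy' G)⟩)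
  have hker : ∀ (k : (levelNumbers T \ {0} : Set ℝ)) (v : E), IsLevelVector T k v →
      ∀ G, minFace v ≠ minFace (y G : E) := by
    intro k v hv G h
    have h1 := hv.norm_le_of_mem_minFace (h ▸ self_mem_minFace (hy' G))
    have h2 : T (y G) = 0 := (y G).2
    rw [h2, norm_zero] at h1
    have h3 := hv.eq_norm_sq
    rw [le_antisymm h1 (norm_nonneg _)] at h3
    exact k.2.2 (by simpa using h3)
  have hpm : ∀ k l : (levelNumbers T \ {0} : Set ℝ), minFace (u k) ≠ minFace (-u l) := by
    intro k l h
    obtain rfl : k = l := Subtype.ext ((hu k).eq_of_minFace_eq (hu l).neg h)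
    exact neg_notMem_minFace (hu k).1 (h ▸ self_mem_minFace (hu k).neg.1)
  have hf : Function.Injective f := by
    refine Function.Injective.sumElim (Function.Injective.sumElim ?_ ?_ ?_) ?_ ?_
    · exact fun k l h =>
        Subtype.ext ((hu k).eq_of_minFace_eq (hu l) (congrArg Subtype.val h))
    · exact fun k l h =>
        Subtype.ext ((hu k).neg.eq_of_minFace_eq (hu l).neg (congrArg Subtype.val h))
    · exact fun k l h => hpm k l (congrArg Subtype.val h)
    · intro G H h
      have h : minFace (y G : E) = minFace (y H : E) := congrArg Subtype.val h
      refine Subtype.ext ?_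
      rw [hG G, hG H]
      ext x
      rw [← coe_mem_minFace_iff, ← coe_mem_minFace_iff, h]
    · rintro (k | k) G h
      · exact hker k _ (hu k) G (congrArg Subtype.val h)
      · exact hker k _ (hu k).neg G (congrArg Subtype.val h)
  have hL : Finite (levelNumbers T \ {0} : Set ℝ) :=
    Finite.of_injective (fun k => f (Sum.inl (Sum.inl k)))
      (hf.comp (Sum.inl_injective.comp Sum.inl_injective))
  refine ⟨hL, ?_⟩
  have := Nat.card_le_card_of_injective f hf
  rw [Nat.card_sum, Nat.card_sum] at this
  rw [← Nat.card_coe_set_eq, ← Nat.card_coe_set_eq, ← Nat.card_coe_set_eq]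
  omega

end LevelNumbers

theorem mainTheorem10 {X : Type*} [NormedAddCommGroup X] [NormedSpace ℝ X]
    (hX : IsPolyhedralSpace X) (n : ℕ) (hn : Module.finrank ℝ X = n) (T : X →L[ℝ] X) :
    (∀ k : ℕ, (unitBallFaces X k).Finite) ∧
    (∀ k : ℕ, (unitBallFaces T.ker k).Finite) ∧
    (levelNumbers T).Finite ∧
    (∀ m : ℕ, 0 < m → Module.finrank ℝ T.ker = m →
      ((levelNumbers T).ncard : ℝ) ≤
        1 / 2 * ((∑ k ∈ Finset.range n, ((unitBallFaces X k).ncard : ℝ)) -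
          (∑ k ∈ Finset.range m, ((unitBallFaces T.ker k).ncard : ℝ))) + 1) ∧
    (Module.finrank ℝ T.ker = 0 →
      ((levelNumbers T).ncard : ℝ) ≤
        1 / 2 * ∑ k ∈ Finset.range n, ((unitBallFaces X k).ncard : ℝ)) := by
  obtain ⟨hfin, hcard⟩ := two_mul_ncard_add_ncard_le hX T
  have hW := hX.submodule T.ker
  have hsub : levelNumbers T ⊆ insert 0 (levelNumbers T \ {0}) := by
    rw [Set.insert_sdiff_singleton]
    exact Set.subset_insert _ _
  have hL : (levelNumbers T).Finite := (hfin.insert 0).subset hsub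
  subst hn
  rw [← sum_ncard_unitBallFaces hX, ← sum_ncard_unitBallFaces hW] at hcard
  refine ⟨fun k => hX.finite_setOf_isUnitBallFace.subset fun F hF => hF.1,
    fun k => hW.finite_setOf_isUnitBallFace.subset fun F hF => hF.1, hL, ?_, ?_⟩
  · rintro m - rfl
    have h1 : (levelNumbers T).ncard ≤ (levelNumbers T \ {0}).ncard + 1 :=
      (Set.ncard_le_ncard hsub (hfin.insert 0)).trans (Set.ncard_insert_le _ _)
    have h1' : ((levelNumbers T).ncard : ℝ) ≤ (levelNumbers T \ {0}).ncard + 1 := by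
      exact_mod_cast h1
    rify at hcard
    linarith
  · intro h0
    have := hX.1
    have hbot : T.ker = ⊥ := Submodule.finrank_eq_zero.1 h0
    -- An injective operator has no level number zero.
    have h0L : (0 : ℝ) ∉ levelNumbers T := by
      intro h
      obtain ⟨u, hu⟩ := IsLevelNumber.exists_isLevelVector h
      have hT : T u = 0 := by simpa using hu.eq_norm_sq.symm
      have hmem : u ∈ T.ker := hT
      rw [hbot, Submodule.mem_bot] at hmem
      simpa [hmem] using hu.1
    rw [Set.sdiff_singleton_eq_self h0L, h0, Finset.sum_range_zero, add_zero] at hcard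
    rify at hcard
    linarith
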